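/- Let $n\ge 1$ be an integer, let $\zeta_n\in\mathbb{C}$ be a primitive $n$-th root of unity, and let $t$, $u$, $v$ be formal variables. For a multi-index $\mathbf{p}=(p_1,\ldots,p_d)$ of positive integers put $$\overline{z}_n(\mathbf{p};\zeta_n)=\sum_{n>m_1>\cdots>m_d>0}\ \prod_{i=1}^{d}\frac{\zeta_n^{(p_i-1)m_i}}{(1-\zeta_n^{m_i})^{p_i}},$$ and for $\mathbf{k}=(k_1,\ldots,k_l)$ put $$\overline{z}_n^t(\mathbf{k};\zeta_n)=\sum_{\mathbf{p}}\overline{z}_n(\mathbf{p};\zeta_n)\,t^{\,l-\mathrm{dep}(\mathbf{p})}\in\mathbb{C}[t],$$ where $\mathbf{p}$ runs over all $(k_1\Box\cdots\Box k_l)$ with each of the $l-1$ boxes filled by "$,$", "$+$" or "$-1+$" (counted once for each filling), and $\mathrm{dep}(\mathbf p)$ is the number of entries of $\mathbf p$; the value at the empty index is $1$. Write $\{k\}^l$ for $k,\ldots,k$ ($l$ terms). (1) For every integer $k\ge 1$, put $\widetilde P^{s}(T)=(1-T)^2-s(1-T)v$ if $k=1$ and $\widetilde P^{s}(T)=(1-T)^k-sT^{k-1}v$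 if $k\ge 2$. Then $\prod_{j=1}^{n-1}\widetilde P^{t}(\zeta_n^j)\neq 0$ and, in the field of fractions of $\mathbb{C}[t][[v]]$, $$\sum_{l=0}^\infty \overline{z}_n^t(\{k\}^l;\zeta_n)\,v^l=\frac{\prod_{j=1}^{n-1}\widetilde P^{t-1}(\zeta_n^j)}{\prod_{j=1}^{n-1}\widetilde P^{t}(\zeta_n^j)}.$$ (2) Let $k\ge 2$. For $s\in\{t,t-1\}$ there are elements $\beta_1^{s},\ldots,\beta_k^{s}$ of an algebraic closure of the field of fractions of $\mathbb{C}[t][[v]]$ whose elementary symmetric polynomials are $e_1=k+(-1)^k s v$ and $e_j=\binom{k}{j}$ for $2\le j\le k$. For any such elements put $\widetilde F_0^{s}=1-u$ and $$\widetilde F_j^{s}=\prod_{1\le i_1<\cdots<i_j\le k}\bigl(1-\beta_{i_1}^{s}\cdots\beta_{i_j}^{s}u\bigr)\qquad(1\le j\le k),$$ and let $H_m^{s}$ ($m\ge 1$) be determined by $$\sum_{m=1}^\infty\frac{H_m^{s}}{m}u^m=(-1)^{k-1}\log\Bigl[\prod_{j=0}^{k}\bigl(\widetilde F_j^{s}\bigr)^{(-1)^j}\Bigr].$$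 Then $H_n^t\ne 0$ and $$\sum_{l=0}^\infty \overline{z}_n^t(\{k\}^l;\zeta_n)\,v^l=\frac{H_n^{t-1}}{H_n^{t}}\cdot\frac{t}{t-1}.$$ -/

import Mathlib

open scoped BigOperators

namespace QHarm

/-- The modified finite multiple harmonic `q`-series
`∑_{n > m₁ > ⋯ > m_l > 0} q^{(k₁-1)m₁+⋯+(k_l-1)m_l} / ((1-q^{m₁})^{k₁} ⋯ (1-q^{m_l})^{k_l})`
of the multi-index `(k₁, …, k_l)` of positive integers, written as an iterated sum
(outermost summation variable `m₁`, then `m₂ < m₁`, and so on); it is `1` for the empty index. -/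
noncomputable def zbar (q : ℂ) : ℕ → List ℕ → ℂ
  | _, [] => 1
  | n, k :: ks =>
      ∑ m ∈ Finset.Ioo 0 n, q ^ ((k - 1) * m) / (1 - q ^ m) ^ k * zbar q m ks

/-- All multi-indices `(a □ k₁ □ ⋯ □ k_l)`, one entry of the list for each way of filling
every box by a comma, by `+`, or by `-1+`. -/
def fillingsAux : ℕ → List ℕ → List (List ℕ)
  | a, [] => [[a]]
  | a, b :: ks =>
      (fillingsAux b ks).map (fun p => a :: p)
        ++ fillingsAux (a + b) ks
        ++ fillingsAux (a - 1 + b) ks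

/-- All multi-indices `(k₁ □ ⋯ □ k_l)`, listed once for each filling of the `l - 1` boxes by
a comma, `+` or `-1+`; the empty index has just the empty filling. -/
def fillings : List ℕ → List (List ℕ)
  | [] => [[]]
  | a :: ks => fillingsAux a ks

/-- The interpolated series `∑_p zbar(p; q) t^{l - dep p}`, a polynomial in the formal
parameter `t`, where `p` runs over all fillings of `(k₁ □ ⋯ □ k_l)`. -/
noncomputable def zbarT (q : ℂ) (n : ℕ) (ks : List ℕ) : Polynomial ℂ :=
  ((fillings ks).map fun p =>
    Polynomial.C (zbar q n p) * Polynomial.X ^ (ks.length - p.length)).sum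

/-- `ℂ[t]⟦v⟧`. -/
abbrev Ser : Type := PowerSeries (Polynomial ℂ)

/-- The field of fractions of `ℂ[t]⟦v⟧`. -/
abbrev Frac : Type := FractionRing Ser

/-- An algebraic closure of the field of fractions of `ℂ[t]⟦v⟧`. -/
abbrev FracBar : Type := AlgebraicClosure Frac

/-- The formal parameter `t` in `ℂ[t]⟦v⟧`. -/
noncomputable def tSer : Ser := PowerSeries.C Polynomial.X

/-- The variable `v` in `ℂ[t]⟦v⟧`. -/
noncomputable def vSer : Ser := PowerSeries.X

/-- The generating function `∑_{l ≥ 0} zbarT({k}^l; q) v^l` in `ℂ[t]⟦v⟧`. -/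
noncomputable def genSer (q : ℂ) (n k : ℕ) : Ser :=
  PowerSeries.mk fun l => zbarT q n (List.replicate l k)

/-- The polynomial `P̃^s(T)`, evaluated at `T`: it is `(1-T)^2 - s(1-T)v` for `k = 1` and
`(1-T)^k - s T^{k-1} v` for `k ≥ 2`. -/
def Ptilde {A : Type*} [CommRing A] (k : ℕ) (s v T : A) : A :=
  if k = 1 then (1 - T) ^ 2 - s * (1 - T) * v else (1 - T) ^ k - s * T ^ (k - 1) * v

/-- The product `∏_{j=1}^{n-1} P̃^s(q^j)` in `ℂ[t]⟦v⟧`. -/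
noncomputable def prodPtilde (q : ℂ) (n k : ℕ) (s : Ser) : Ser :=
  ∏ j ∈ Finset.Ico 1 n, Ptilde k s vSer (algebraMap ℂ Ser (q ^ j))

/-- `β₁, …, β_k` have elementary symmetric polynomials `e₁ = k + (-1)^k s v` and
`e_j = binom k j` for `2 ≤ j ≤ k`. -/
def IsBeta {L : Type*} [Field L] (k : ℕ) (s v : L) (β : Fin k → L) : Prop :=
  ∀ j : ℕ, 1 ≤ j → j ≤ k →
    ∑ S ∈ Finset.powersetCard j (Finset.univ : Finset (Fin k)), ∏ i ∈ S, β i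
      = if j = 1 then (k : L) + (-1) ^ k * s * v else (k.choose j : L)

/-- `F̃_j = ∏_{i₁ < ⋯ < i_j} (1 - β_{i₁} ⋯ β_{i_j} u)` as a series in `u`;
for `j = 0` this is `1 - u`, the only subset being the empty one. -/
noncomputable def Ftilde {L : Type*} [Field L] {k : ℕ} (β : Fin k → L) (j : ℕ) :
    PowerSeries L :=
  ∏ S ∈ Finset.powersetCard j (Finset.univ : Finset (Fin k)),
    (1 - PowerSeries.C (∏ i ∈ S, β i) * PowerSeries.X)

/-- `∏_{j=0}^k F̃_j^{(-1)^j}` as a series in `u` (every `F̃_j` has constant term `1`, so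
`⁻¹` is the inverse power series). -/
noncomputable def altProd {L : Type*} [Field L] {k : ℕ} (β : Fin k → L) : PowerSeries L :=
  ∏ j ∈ Finset.range (k + 1), if Even j then Ftilde β j else (Ftilde β j)⁻¹

/-- `H` is the sequence determined by
`∑_{m ≥ 1} (H_m / m) u^m = (-1)^{k-1} log (∏_{j=0}^k F̃_j^{(-1)^j})`
(the coefficient of `u^0` on the left is `H 0 / 0 = 0`). -/
def IsH {L : Type*} [Field L] [Algebra ℚ L] {k : ℕ} (β : Fin k → L) (H : ℕ → L) : Prop :=
  PowerSeries.mk (fun m : ℕ => H m / (m : L))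
    = (-1) ^ (k - 1) * PowerSeries.logOf (altProd β)

end QHarm

/-! Put w(m) = ζ^{(k-1)m}/(1-ζ^m)^k. At a common summation index the fillings "+" and "-1+" add up
to the product of the two weights (`weight_mul_weight`), so the interpolated sum runs over m₁ ≥ ⋯ ≥
m_l with a factor t for each equality. Each m then contributes independently 1 + wv/(1 - twv) = (1 -
(t-1)wv)/(1 - twv). This is `genSer_mul_prod`; multiplying numerator and denominator by powers of 1
- ζ^m gives (1).

For (2), the logarithm turns the alternating product over subsets into H_m = ∏ᵢ(βᵢ^m - 1)
(`IsH.eq_prod`). By Vieta ∏ᵢ(βᵢ - T) = P̃^s(T) (`IsBeta.prod_sub`), so factoring x^n - 1 gives H_n^s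
= ∏_{j=0}^{n-1} P̃^s(ζ^j). The extra factor P̃^s(1) = -sv accounts for t/(t-1). -/

namespace PowerSeries

/-! ### Logarithms of formal power series with constant term 1. -/

section LogOf

variable {L : Type*} [Field L] [Algebra ℚ L]

theorem one_add_X_mul_deriv_log : (1 + X : L⟦X⟧) * d⁄dX L (log L) = 1 := by
  rw [deriv_log]
  ext n
  rw [add_mul, one_mul, map_add]
  cases n with
  | zero => simp
  | succ n => simp [coeff_succ_X_mul, coeff_one, pow_succ]

theorem mul_deriv_logOf {f : L⟦X⟧} (hf : constantCoeff f = 1) :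
    f * d⁄dX L (logOf f) = d⁄dX L f := by
  have hs : HasSubst (f - 1) := HasSubst.of_constantCoeff_zero' (by simp [hf])
  have h := congrArg (subst (f - 1)) (one_add_X_mul_deriv_log (L := L))
  have h1 : subst (f - 1) (1 : L⟦X⟧) = (1 : L⟦X⟧) := by
    rw [← coe_substAlgHom hs, map_one]
  rw [subst_mul hs, subst_add hs, subst_X hs, h1, add_sub_cancel] at h
  rw [logOf_eq, derivative_subst hs, ← mul_assoc, h, one_mul, map_sub, derivative_one, sub_zero]

/-- In characteristic zero a series is fixed by its derivative and constant term; the logarithm laws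
below reduce to this. -/
theorem logOf_eq_of_mul_deriv_eq {f g : L⟦X⟧} (hf : constantCoeff f = 1)
    (hg : constantCoeff g = 0) (h : f * d⁄dX L g = d⁄dX L f) : logOf f = g := by
  have : CharZero L := algebraRat.charZero L
  have hf0 : f ≠ 0 := fun h0 => by simp [h0] at hf
  refine derivative.ext (mul_left_cancel₀ hf0 ?_) ?_
  · rw [mul_deriv_logOf hf, h]
  · rw [constantCoeff_logOf hf, hg]

theorem logOf_one : logOf (1 : L⟦X⟧) = 0 :=
  logOf_eq_of_mul_deriv_eq (by simp) (by simp) (by simp)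

theorem logOf_mul {f g : L⟦X⟧} (hf : constantCoeff f = 1) (hg : constantCoeff g = 1) :
    logOf (f * g) = logOf f + logOf g := by
  refine logOf_eq_of_mul_deriv_eq (by simp [hf, hg]) ?_ ?_
  · rw [map_add, constantCoeff_logOf hf, constantCoeff_logOf hg, add_zero]
  · rw [map_add, Derivation.leibniz, ← mul_deriv_logOf hf, ← mul_deriv_logOf hg]
    simp only [smul_eq_mul]
    ring

theorem logOf_inv {f : L⟦X⟧} (hf : constantCoeff f = 1) : logOf f⁻¹ = -logOf f := by
  have hi : constantCoeff f⁻¹ = 1 := by simp [hf]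
  have h := logOf_mul hf hi
  rw [PowerSeries.mul_inv_cancel f (by simp [hf]), logOf_one] at h
  exact (neg_eq_of_add_eq_zero_right h.symm).symm

theorem logOf_prod {ι : Type*} (s : Finset ι) (f : ι → L⟦X⟧)
    (hf : ∀ i ∈ s, constantCoeff (f i) = 1) :
    logOf (∏ i ∈ s, f i) = ∑ i ∈ s, logOf (f i) := by
  classical
  induction s using Finset.induction_on with
  | empty => simp [logOf_one]
  | insert a s ha ih =>
    have hs : ∀ i ∈ s, constantCoeff (f i) = 1 := fun i hi => hf i (Finset.mem_insert_of_mem hi)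
    rw [Finset.prod_insert ha, Finset.sum_insert ha,
      logOf_mul (hf a (Finset.mem_insert_self a s)) ?_, ih hs]
    rw [map_prod, Finset.prod_congr rfl hs, Finset.prod_const_one]

theorem logOf_one_sub_C_mul_X (a : L) :
    logOf (1 - C a * X : L⟦X⟧) = mk fun m => -(a ^ m / m) := by
  have : CharZero L := algebraRat.charZero L
  refine logOf_eq_of_mul_deriv_eq (by simp) (by simp) ?_
  ext n
  rw [sub_mul, one_mul, map_sub, mul_assoc, coeff_C_mul]
  cases n with
  | zero => simp [coeff_derivative]
  | succ n =>
    have h1 : (n : L) + 1 ≠ 0 := by exact_mod_cast Nat.succ_ne_zero n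
    have h2 : (n : L) + 1 + 1 ≠ 0 := by exact_mod_cast Nat.succ_ne_zero (n + 1)
    rw [coeff_succ_X_mul]
    simp only [coeff_derivative, coeff_mk, map_sub, coeff_C_mul, coeff_X, coeff_one]
    push_cast
    field_simp
    simp [pow_succ]
    ring

end LogOf

end PowerSeries

namespace QHarm

/-! ### The elements β and the closed form of H. -/

section Beta

variable {L : Type*} [Field L] {k : ℕ}

theorem constantCoeff_Ftilde (β : Fin k → L) (j : ℕ) :
    PowerSeries.constantCoeff (Ftilde β j) = 1 := by
  simp [Ftilde, map_prod]

theorem sum_powerset_prod_pow (β : Fin k → L) (m : ℕ) :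
    ∑ j ∈ Finset.range (k + 1), (-1) ^ j *
      ∑ S ∈ Finset.powersetCard j (Finset.univ : Finset (Fin k)), (∏ i ∈ S, β i) ^ m
      = ∏ i, (1 - β i ^ m) := by
  have h := Finset.prod_one_add (f := fun i => -β i ^ m) (Finset.univ : Finset (Fin k))
  simp only [← sub_eq_add_neg] at h
  rw [h, Finset.sum_powerset, Finset.card_univ, Fintype.card_fin]
  refine Finset.sum_congr rfl fun j _ => ?_
  rw [Finset.mul_sum]
  refine Finset.sum_congr rfl fun S hS => ?_
  rw [Finset.prod_neg, (Finset.mem_powersetCard.mp hS).2, Finset.prod_pow]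

theorem constantCoeff_altProd (β : Fin k → L) :
    PowerSeries.constantCoeff (altProd β) = 1 := by
  rw [altProd, map_prod]
  refine Finset.prod_eq_one fun j _ => ?_
  split_ifs <;> simp [constantCoeff_Ftilde]

variable [Algebra ℚ L]

theorem coeff_logOf_altProd (β : Fin k → L) (m : ℕ) :
    PowerSeries.coeff m (PowerSeries.logOf (altProd β)) = -((∏ i, (1 - β i ^ m)) / m) := by
  have hF : ∀ j, PowerSeries.coeff m (PowerSeries.logOf (Ftilde β j))
      = -((∑ S ∈ Finset.powersetCard j (Finset.univ : Finset (Fin k)),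
          (∏ i ∈ S, β i) ^ m) / m) := fun j => by
    rw [Ftilde, PowerSeries.logOf_prod _ _ fun S _ => by simp, map_sum, Finset.sum_div,
      ← Finset.sum_neg_distrib]
    refine Finset.sum_congr rfl fun S _ => ?_
    rw [PowerSeries.logOf_one_sub_C_mul_X, PowerSeries.coeff_mk]
  rw [altProd, PowerSeries.logOf_prod _ _ fun j _ => by
    split_ifs <;> simp [constantCoeff_Ftilde], map_sum, ← sum_powerset_prod_pow, Finset.sum_div,
    ← Finset.sum_neg_distrib]
  refine Finset.sum_congr rfl fun j _ => ?_
  split_ifs with hj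
  · rw [hF, hj.neg_one_pow, one_mul]
  · rw [PowerSeries.logOf_inv (constantCoeff_Ftilde β j), map_neg, hF,
      (Nat.not_even_iff_odd.mp hj).neg_one_pow]
    ring

theorem IsH.eq_prod {β : Fin k → L} {H : ℕ → L} (hk : 1 ≤ k) (h : IsH β H) {m : ℕ}
    (hm : 0 < m) : H m = ∏ i, (β i ^ m - 1) := by
  have : CharZero L := algebraRat.charZero L
  have hm0 : (m : L) ≠ 0 := by exact_mod_cast hm.ne'
  have h1 := congrArg (PowerSeries.coeff m) h
  have h2 : ((-1) ^ (k - 1) : PowerSeries L) = PowerSeries.C ((-1) ^ (k - 1)) := by simp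
  rw [PowerSeries.coeff_mk, h2, PowerSeries.coeff_C_mul, coeff_logOf_altProd] at h1
  -- The sign (-1)^(k-1) and the minus sign of the logarithm together turn every 1 - βᵢ^m into βᵢ^m
  -- - 1.
  have h3 : ∏ i, (β i ^ m - 1) = (-1) ^ k * ∏ i, (1 - β i ^ m) := by
    simp_rw [← neg_sub (1 : L) (β _ ^ m)]
    rw [Finset.prod_neg, Finset.card_univ, Fintype.card_fin]
  obtain ⟨k, rfl⟩ := Nat.exists_eq_add_of_le' hk
  rw [h3, ← div_left_inj' hm0, h1]
  simp only [Nat.add_sub_cancel, pow_succ]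
  ring

theorem exists_isH (β : Fin k → L) : ∃ H : ℕ → L, IsH β H := by
  have : CharZero L := algebraRat.charZero L
  refine ⟨fun m => m * PowerSeries.coeff m
    ((-1) ^ (k - 1) * PowerSeries.logOf (altProd β)), ?_⟩
  ext m
  rw [PowerSeries.coeff_mk]
  rcases Nat.eq_zero_or_pos m with rfl | hm
  -- At m = 0 division by zero gives 0, which matches the vanishing constant term of the logarithm.
  · simp [PowerSeries.constantCoeff_logOf (constantCoeff_altProd β)]
  · rw [mul_div_cancel_left₀]
    exact_mod_cast hm.ne'

omit [Algebra ℚ L]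

theorem IsBeta.prod_sub {s v : L} {β : Fin k → L} (hk : 2 ≤ k) (h : IsBeta k s v β) (T : L) :
    ∏ i, (β i - T) = Ptilde k s v T := by
  have h1 : ∏ i, (β i - T) = ∑ j ∈ Finset.range (k + 1),
      (if j = 1 then (k : L) + (-1) ^ k * s * v else (k.choose j : L)) * (-T) ^ (k - j) := by
    simp_rw [sub_eq_add_neg]
    rw [Finset.prod_add, Finset.sum_powerset, Finset.card_univ, Fintype.card_fin]
    refine Finset.sum_congr rfl fun j hj => ?_
    have hjk : j ≤ k := Nat.lt_succ_iff.mp (Finset.mem_range.mp hj)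
    have he : ∑ S ∈ Finset.powersetCard j (Finset.univ : Finset (Fin k)), ∏ i ∈ S, β i
        = if j = 1 then (k : L) + (-1) ^ k * s * v else (k.choose j : L) := by
      rcases Nat.eq_zero_or_pos j with rfl | hj0
      · simp
      · exact h j hj0 hjk
    rw [← he, Finset.sum_mul]
    refine Finset.sum_congr rfl fun S hS => ?_
    rw [Finset.prod_const, Finset.card_sdiff_of_subset (Finset.subset_univ S),
      (Finset.mem_powersetCard.mp hS).2, Finset.card_univ, Fintype.card_fin]
  -- Only e₁ differs from the binomial coefficient, so the sum is the expansion of (1 - T)^k plus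
  -- one term.
  have h2 : ∀ j, (if j = 1 then (k : L) + (-1) ^ k * s * v else (k.choose j : L))
      * (-T) ^ (k - j)
      = 1 ^ j * (-T) ^ (k - j) * (k.choose j : L)
        + if j = 1 then (-1) ^ k * s * v * (-T) ^ (k - 1) else 0 := fun j => by
    split_ifs with hj
    · subst hj; rw [Nat.choose_one_right]; ring
    · ring
  rw [h1, Finset.sum_congr rfl fun j _ => h2 j, Finset.sum_add_distrib, ← add_pow,
    Finset.sum_ite_eq' , if_pos (Finset.mem_range.mpr (by lia)), Ptilde, if_neg (by lia),
    neg_pow T]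
  obtain ⟨k, rfl⟩ := Nat.exists_eq_add_of_le' (show 1 ≤ k by lia)
  have h3 : ((-1 : L) ^ k) ^ 2 = 1 := by rw [← pow_mul, mul_comm, pow_mul]; simp
  simp only [Nat.add_sub_cancel]
  linear_combination (-(s * v * T ^ k)) * h3

theorem IsBeta.prod_pow_sub_one {s v ζ : L} {β : Fin k → L} (hk : 2 ≤ k)
    (h : IsBeta k s v β) {n : ℕ} (hn : 0 < n) (hζ : IsPrimitiveRoot ζ n) :
    ∏ i, (β i ^ n - 1) = -(s * v) * ∏ j ∈ Finset.Ico 1 n, Ptilde k s v (ζ ^ j) := by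
  have h1 : ∀ x : L, x ^ n - 1 = ∏ j ∈ Finset.range n, (x - ζ ^ j) := fun x => by
    simpa [Polynomial.eval_prod] using
      congrArg (Polynomial.eval x) (X_pow_sub_C_eq_prod hζ hn (one_pow n))
  simp_rw [h1]
  rw [Finset.prod_comm, Finset.prod_congr rfl fun j _ => h.prod_sub hk (ζ ^ j),
    Finset.range_eq_Ico, Finset.prod_eq_prod_Ico_succ_bot hn]
  congr 1
  -- The factor j = 0 is P̃(1) = -sv, since (1 - 1)^k = 0.
  rw [Ptilde, if_neg (by lia)]
  simp [show k ≠ 0 by lia]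

/-- The roots of (X - 1)^k - (-1)^k s v X^(k-1) work by Vieta: the second term changes only the
coefficient that gives e₁. -/
theorem exists_isBeta [IsAlgClosed L] (hk : 1 ≤ k) (s v : L) :
    ∃ β : Fin k → L, IsBeta k s v β := by
  set c : L := (-1) ^ k * s * v with hc
  set p : Polynomial L := (Polynomial.X + Polynomial.C (-1)) ^ k
    - Polynomial.C c * Polynomial.X ^ (k - 1) with hp
  have hm : ((Polynomial.X + Polynomial.C (-1) : Polynomial L) ^ k).Monic :=
    (Polynomial.monic_X_add_C (-1 : L)).pow k
  have hdk : ((Polynomial.X + Polynomial.C (-1) : Polynomial L) ^ k).natDegree = k := by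
    rw [Polynomial.natDegree_pow, Polynomial.natDegree_X_add_C, mul_one]
  have hlt : (Polynomial.C c * Polynomial.X ^ (k - 1)).degree
      < ((Polynomial.X + Polynomial.C (-1) : Polynomial L) ^ k).degree := by
    rw [Polynomial.degree_eq_natDegree hm.ne_zero, hdk]
    exact (Polynomial.degree_C_mul_X_pow_le _ _).trans_lt (by exact_mod_cast (by lia))
  have hmonic : p.Monic := hm.sub_of_left hlt
  have hdeg : p.natDegree = k := by
    rw [← hdk]
    exact Polynomial.natDegree_eq_of_degree_eq (Polynomial.degree_sub_eq_left_of_degree_lt hlt)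
  have hcard : p.roots.card = p.natDegree := IsAlgClosed.card_roots_eq_natDegree
  obtain ⟨l, hl⟩ := Quot.exists_rep p.roots
  have hll : l.length = k := by
    rw [← hdeg, ← hcard, ← hl]; rfl
  refine ⟨fun i => l.get (i.cast hll.symm), fun j hj1 hjk => ?_⟩
  have hmap : (Finset.univ : Finset (Fin k)).val.map (fun i => l.get (i.cast hll.symm))
      = p.roots := by
    subst hll
    rw [← hl]
    exact congrArg _ ((List.ofFn_eq_map (f := l.get)).symm.trans (List.ofFn_get l))
  rw [← Finset.esymm_map_val, hmap]
  have h := Polynomial.coeff_eq_esymm_roots_of_card hcard (k := k - j) (by lia)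
  rw [hmonic.leadingCoeff, one_mul, hdeg, Nat.sub_sub_self hjk] at h
  have hs : ((-1 : L) ^ j) * (-1) ^ j = 1 := by rw [← mul_pow]; simp
  have he : p.roots.esymm j = (-1) ^ j * p.coeff (k - j) := by
    rw [h, ← mul_assoc, hs, one_mul]
  rw [he, hp, Polynomial.coeff_sub, Polynomial.coeff_X_add_C_pow, Polynomial.coeff_C_mul,
    Polynomial.coeff_X_pow, Nat.sub_sub_self hjk, Nat.choose_symm hjk, mul_sub, ← mul_assoc, hs]
  split_ifs with h1 h2 h2
  · subst h2
    rw [Nat.choose_one_right]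
    ring
  · lia
  · lia
  · ring

end Beta

end QHarm

namespace QHarm

/-! ### Interpolated sums as sums over weakly decreasing indices. -/

section Fillings

theorem length_le_of_mem_fillingsAux {ks : List ℕ} {a : ℕ} {p : List ℕ}
    (hp : p ∈ fillingsAux a ks) : p.length ≤ ks.length + 1 := by
  induction ks generalizing a p with
  | nil => simp_all [fillingsAux]
  | cons b ks ih =>
    simp only [fillingsAux, List.mem_append, List.mem_map] at hp
    rcases hp with (⟨p, hp, rfl⟩ | hp) | hp
    · simpa using ih hp
    · exact (ih hp).trans (by simp)
    · exact (ih hp).trans (by simp)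

open Polynomial in
/-- The interpolated series attached to `(a □ k₁ □ ⋯ □ k_l)`. -/
noncomputable def zbarTAux (q : ℂ) (n a : ℕ) (ks : List ℕ) : ℂ[X] :=
  ((fillingsAux a ks).map fun p => C (zbar q n p) * X ^ (ks.length + 1 - p.length)).sum

/-- The weight `q^{(k-1)m} / (1-q^m)^k` of a single entry. -/
noncomputable def weight (q : ℂ) (k m : ℕ) : ℂ := q ^ ((k - 1) * m) / (1 - q ^ m) ^ k

theorem weight_mul_weight {q : ℂ} {m a k : ℕ} (ha : 1 ≤ a) (hk : 1 ≤ k) (hq : q ^ m ≠ 1) :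
    weight q (a + k) m + weight q (a - 1 + k) m = weight q a m * weight q k m := by
  have h : 1 - q ^ m ≠ 0 := sub_ne_zero.mpr (Ne.symm hq)
  obtain ⟨a, rfl⟩ := Nat.exists_eq_add_of_le' ha
  obtain ⟨k, rfl⟩ := Nat.exists_eq_add_of_le' hk
  have h1 : a + 1 + (k + 1) - 1 = a + k + 1 := by lia
  have h2 : a + (k + 1) = a + k + 1 := by lia
  simp only [weight, h1, Nat.add_sub_cancel, h2]
  field_simp
  ring

open Polynomial

/-- A comma leaves the difference of length and depth unchanged; either merge raises it by one,
hence the factor `X`. -/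
theorem zbarTAux_cons (q : ℂ) (n a b : ℕ) (ks : List ℕ) :
    zbarTAux q n a (b :: ks)
      = ∑ m ∈ Finset.Ioo 0 n, C (weight q a m) * zbarTAux q m b ks
        + X * (zbarTAux q n (a + b) ks + zbarTAux q n (a - 1 + b) ks) := by
  have h1 : ∀ c, ((fillingsAux c ks).map fun p =>
      C (zbar q n p) * X ^ ((b :: ks).length + 1 - p.length)).sum
      = X * zbarTAux q n c ks := fun c => by
    rw [zbarTAux, ← List.sum_map_mul_left]
    refine congrArg _ (List.map_congr_left fun p hp => ?_)
    have := length_le_of_mem_fillingsAux hp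
    rw [List.length_cons, show ks.length + 1 + 1 - p.length = ks.length + 1 - p.length + 1 by lia,
      pow_succ]
    ring
  have h2 : ∀ l : List (List ℕ), (l.map fun p =>
      C (zbar q n (a :: p)) * X ^ (ks.length + 1 - p.length)).sum
      = ∑ m ∈ Finset.Ioo 0 n, C (weight q a m) *
        (l.map fun p => C (zbar q m p) * X ^ (ks.length + 1 - p.length)).sum := fun l => by
    induction l with
    | nil => simp
    | cons p l ih =>
      simp only [List.map_cons, List.sum_cons, mul_add, Finset.sum_add_distrib, ← ih]
      rw [zbar, map_sum, Finset.sum_mul]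
      simp only [weight, map_mul, mul_assoc]
  rw [zbarTAux, fillingsAux, List.map_append, List.map_append, List.sum_append, List.sum_append,
    h1, h1, List.map_map, mul_add, add_assoc]
  congr 1
  simp only [zbarTAux, ← h2]
  refine congrArg _ (List.map_congr_left fun p _ => ?_)
  simp

/-- The coefficient of `w(m) v^{l+1}` in the part of the generating function of the
interpolated sums with weight `w` whose largest summation index is `m`. -/
noncomputable def tailSum (w : ℕ → ℂ) : ℕ → ℕ → ℂ[X]
  | 0, _ => 1
  | l + 1, m => ∑ j ∈ Finset.Ioo 0 m, C (w j) * tailSum w l j + X * C (w m) * tailSum w l m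

/-- The first entry `a` stays general because a merge replaces it by `a + k` or `a - 1 + k`, and the
bound `n` because the inner sum runs below `m`. -/
theorem zbarTAux_replicate {q : ℂ} {k : ℕ} (hk : 1 ≤ k) (l : ℕ) {n a : ℕ} (ha : 1 ≤ a)
    (hq : ∀ m ∈ Finset.Ioo 0 n, q ^ m ≠ 1) :
    zbarTAux q n a (List.replicate l k)
      = ∑ m ∈ Finset.Ioo 0 n, C (weight q a m) * tailSum (weight q k) l m := by
  induction l generalizing n a with
  | zero => simp [zbarTAux, fillingsAux, zbar, tailSum, weight]
  | succ l ih =>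
    rw [List.replicate_succ, zbarTAux_cons, ih (by lia) hq, ih (by lia) hq,
      ← Finset.sum_add_distrib, Finset.mul_sum, ← Finset.sum_add_distrib]
    refine Finset.sum_congr rfl fun m hm => ?_
    rw [ih hk fun j hj => hq j ?_, ← add_mul, ← C_add, weight_mul_weight ha hk (hq m hm), tailSum,
      C_mul]
    · ring
    · rw [Finset.mem_Ioo] at hj hm ⊢
      lia

theorem zbarT_replicate_zero (q : ℂ) (n k : ℕ) : zbarT q n (List.replicate 0 k) = 1 := by
  simp [zbarT, fillings, zbar]

theorem zbarT_replicate_succ {q : ℂ} {k : ℕ} (hk : 1 ≤ k) (l : ℕ) {n : ℕ}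
    (hq : ∀ m ∈ Finset.Ioo 0 n, q ^ m ≠ 1) :
    zbarT q n (List.replicate (l + 1) k)
      = ∑ m ∈ Finset.Ioo 0 n, C (weight q k m) * tailSum (weight q k) l m := by
  rw [← zbarTAux_replicate hk l hk hq, List.replicate_succ, zbarT, fillings, zbarTAux,
    List.length_cons]

end Fillings

/-! ### The generating function as a product over m. -/

section GenSer

theorem algebraMap_complex_ser (c : ℂ) :
    algebraMap ℂ Ser c = PowerSeries.C (Polynomial.C c) := by
  rw [PowerSeries.algebraMap_apply, Polynomial.algebraMap_eq]

theorem genSer_eq {q : ℂ} {k : ℕ} (hk : 1 ≤ k) {n : ℕ}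
    (hq : ∀ m ∈ Finset.Ioo 0 n, q ^ m ≠ 1) :
    genSer q n k = 1 + vSer * ∑ m ∈ Finset.Ioo 0 n,
      algebraMap ℂ Ser (weight q k m) * PowerSeries.mk fun l => tailSum (weight q k) l m := by
  ext1 l
  simp only [algebraMap_complex_ser, genSer, vSer, PowerSeries.coeff_mk, map_add]
  cases l with
  | zero => rw [zbarT_replicate_zero]; simp
  | succ l =>
    rw [PowerSeries.coeff_succ_X_mul, zbarT_replicate_succ hk l hq, map_sum]
    simp [PowerSeries.coeff_one, PowerSeries.coeff_C_mul]

/-- The second term in the recursion of `tailSum` repeats the index n at the cost t w(n) v. Moving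
it to the left leaves only smaller indices, which sum to `genSer`. -/
theorem mul_mk_tailSum {q : ℂ} {k : ℕ} (hk : 1 ≤ k) {n : ℕ}
    (hq : ∀ m ∈ Finset.Ioo 0 n, q ^ m ≠ 1) :
    (1 - tSer * algebraMap ℂ Ser (weight q k n) * vSer)
      * PowerSeries.mk (fun l => tailSum (weight q k) l n) = genSer q n k := by
  ext1 l
  simp only [algebraMap_complex_ser, genSer, vSer, tSer, PowerSeries.coeff_mk, sub_mul, one_mul,
    map_sub]
  rw [mul_assoc, ← map_mul, PowerSeries.coeff_C_mul]
  cases l with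
  | zero => rw [zbarT_replicate_zero]; simp [tailSum]
  | succ l =>
    rw [PowerSeries.coeff_succ_X_mul, zbarT_replicate_succ hk l hq, PowerSeries.coeff_mk, tailSum]
    ring

/-- With G_n the generating function and A the `tailSum` series at n, G_{n+1} = G_n + v w(n) A and
(1 - t w(n) v) A = G_n. Hence passing to n + 1 multiplies G_n by (1 - (t-1) w(n) v)/(1 - t w(n) v).
-/
theorem genSer_mul_prod {q : ℂ} {k : ℕ} (hk : 1 ≤ k) {n : ℕ} (hn : 1 ≤ n)
    (hq : ∀ m ∈ Finset.Ioo 0 n, q ^ m ≠ 1) :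
    genSer q n k * ∏ m ∈ Finset.Ico 1 n, (1 - tSer * algebraMap ℂ Ser (weight q k m) * vSer)
      = ∏ m ∈ Finset.Ico 1 n, (1 - (tSer - 1) * algebraMap ℂ Ser (weight q k m) * vSer) := by
  induction n, hn using Nat.le_induction with
  | base =>
    rw [genSer_eq hk hq, show Finset.Ioo 0 1 = (∅ : Finset ℕ) from rfl]
    simp
  | succ n hn ih =>
    have hq' : ∀ m ∈ Finset.Ioo 0 n, q ^ m ≠ 1 := fun m hm => hq m (by
      rw [Finset.mem_Ioo] at hm ⊢; lia)
    have hI : Finset.Ioo 0 (n + 1) = insert n (Finset.Ioo 0 n) := by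
      ext m; simp only [Finset.mem_Ioo, Finset.mem_insert]; lia
    have h1 := genSer_eq hk hq
    rw [hI, Finset.sum_insert (by simp), mul_add, add_left_comm, ← genSer_eq hk hq'] at h1
    rw [Finset.prod_Ico_succ_top hn, Finset.prod_Ico_succ_top hn, ← ih hq', h1,
      ← mul_mk_tailSum hk hq']
    ring

/-- The factor `(1-T)^2` for `k = 1` and `(1-T)^k` for `k ≥ 2` at `T = q^m`. -/
noncomputable def denom (q : ℂ) (k m : ℕ) : ℂ := (1 - q ^ m) ^ (if k = 1 then 2 else k)

theorem Ptilde_eq {q : ℂ} {k m : ℕ} (s : Ser) (hq : q ^ m ≠ 1) :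
    Ptilde k s vSer (algebraMap ℂ Ser (q ^ m))
      = algebraMap ℂ Ser (denom q k m)
        * (1 - s * algebraMap ℂ Ser (weight q k m) * vSer) := by
  have h : 1 - q ^ m ≠ 0 := sub_ne_zero.mpr (Ne.symm hq)
  have hw : algebraMap ℂ Ser (denom q k m * weight q k m)
      = algebraMap ℂ Ser (denom q k m) * algebraMap ℂ Ser (weight q k m) := map_mul _ _ _
  have e : algebraMap ℂ Ser (denom q k m)
        * (1 - s * algebraMap ℂ Ser (weight q k m) * vSer)
      = algebraMap ℂ Ser (denom q k m)
        - s * algebraMap ℂ Ser (denom q k m * weight q k m) * vSer := by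
    rw [hw]; ring
  rw [e, Ptilde]
  split_ifs with hk
  · subst hk
    have : denom q 1 m * weight q 1 m = 1 - q ^ m := by
      simp only [denom, weight, if_true]; field_simp; simp
    rw [this, denom, if_pos rfl, map_pow _ (1 - q ^ m), map_sub, map_one]
  · have : denom q k m * weight q k m = (q ^ m) ^ (k - 1) := by
      simp only [denom, weight, if_neg hk]; field_simp; rw [← pow_mul]; ring
    rw [this, denom, if_neg hk, map_pow _ (1 - q ^ m), map_sub, map_one, map_pow _ (q ^ m)]

theorem prodPtilde_eq {q : ℂ} {n k : ℕ} (s : Ser) (hq : ∀ m ∈ Finset.Ioo 0 n, q ^ m ≠ 1) :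
    prodPtilde q n k s = (∏ m ∈ Finset.Ico 1 n, algebraMap ℂ Ser (denom q k m))
      * ∏ m ∈ Finset.Ico 1 n, (1 - s * algebraMap ℂ Ser (weight q k m) * vSer) := by
  rw [prodPtilde, ← Finset.prod_mul_distrib]
  exact Finset.prod_congr rfl fun m hm => Ptilde_eq s (hq m hm)

theorem genSer_mul_prodPtilde {q : ℂ} {n k : ℕ} (hk : 1 ≤ k) (hn : 1 ≤ n)
    (hq : ∀ m ∈ Finset.Ioo 0 n, q ^ m ≠ 1) :
    genSer q n k * prodPtilde q n k tSer = prodPtilde q n k (tSer - 1) := by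
  rw [prodPtilde_eq _ hq, prodPtilde_eq _ hq, ← genSer_mul_prod hk hn hq]
  ring

theorem prodPtilde_ne_zero {q : ℂ} {n k : ℕ} (s : Ser)
    (hq : ∀ m ∈ Finset.Ioo 0 n, q ^ m ≠ 1) : prodPtilde q n k s ≠ 0 := by
  refine Finset.prod_ne_zero_iff.mpr fun m hm h0 => ?_
  rw [Ptilde_eq s (hq m hm)] at h0
  -- At v = 0 the factor reduces to the nonzero constant `denom q k m`.
  have h := congrArg PowerSeries.constantCoeff h0
  have h1 : denom q k m ≠ 0 := pow_ne_zero _ (sub_ne_zero.mpr (Ne.symm (hq m hm)))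
  simp [algebraMap_complex_ser, vSer, h1] at h

theorem map_Ptilde {A B : Type*} [CommRing A] [CommRing B] (f : A →+* B) (k : ℕ) (s v T : A) :
    f (Ptilde k s v T) = Ptilde k (f s) (f v) (f T) := by
  unfold Ptilde
  split_ifs <;> simp

theorem tSer_ne_zero : tSer ≠ 0 := fun h => by
  simpa [tSer] using congrArg PowerSeries.constantCoeff h

theorem tSer_sub_one_ne_zero : tSer - 1 ≠ 0 := fun h => by
  have h := congrArg PowerSeries.constantCoeff h
  rw [tSer, map_sub, PowerSeries.constantCoeff_C, map_one, map_zero] at h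
  exact Polynomial.X_sub_C_ne_zero (1 : ℂ) h

theorem algebraMap_ser_fracBar_injective : Function.Injective (algebraMap Ser FracBar) := by
  rw [IsScalarTower.algebraMap_eq Ser Frac FracBar]
  exact (algebraMap Frac FracBar).injective.comp (IsFractionRing.injective Ser Frac)

theorem IsBeta.prod_pow_sub_one_eq_algebraMap {n k : ℕ} (hn : 0 < n) (hk : 2 ≤ k) {ζ : ℂ}
    (hζ : IsPrimitiveRoot ζ n) {s : Ser} {β : Fin k → FracBar}
    (h : IsBeta k (algebraMap Ser FracBar s) (algebraMap Ser FracBar vSer) β) :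
    ∏ i, (β i ^ n - 1) = algebraMap Ser FracBar (-(s * vSer) * prodPtilde ζ n k s) := by
  have hζ' : IsPrimitiveRoot (algebraMap Ser FracBar (algebraMap ℂ Ser ζ)) n :=
    (hζ.map_of_injective (algebraMap ℂ Ser).injective).map_of_injective
      algebraMap_ser_fracBar_injective
  rw [h.prod_pow_sub_one hk hn hζ', prodPtilde, map_mul, map_neg, map_mul, map_prod]
  simp only [map_Ptilde, map_pow]

end GenSer

end QHarm

theorem mainTheorem6 (n : ℕ) (hn : 0 < n) (ζ : ℂ) (hζ : IsPrimitiveRoot ζ n) :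
    (∀ k : ℕ, 1 ≤ k →
      QHarm.prodPtilde ζ n k QHarm.tSer ≠ 0 ∧
      algebraMap QHarm.Ser QHarm.Frac (QHarm.genSer ζ n k)
        = algebraMap QHarm.Ser QHarm.Frac (QHarm.prodPtilde ζ n k (QHarm.tSer - 1))
          / algebraMap QHarm.Ser QHarm.Frac (QHarm.prodPtilde ζ n k QHarm.tSer)) ∧
    (∀ k : ℕ, 2 ≤ k → ∀ t v : QHarm.FracBar,
      t = algebraMap QHarm.Ser QHarm.FracBar QHarm.tSer →
      v = algebraMap QHarm.Ser QHarm.FracBar QHarm.vSer →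
      (∃ β : Fin k → QHarm.FracBar, QHarm.IsBeta k t v β ∧
        ∃ H : ℕ → QHarm.FracBar, QHarm.IsH β H) ∧
      (∃ β' : Fin k → QHarm.FracBar, QHarm.IsBeta k (t - 1) v β' ∧
        ∃ H' : ℕ → QHarm.FracBar, QHarm.IsH β' H') ∧
      ∀ (β β' : Fin k → QHarm.FracBar) (H H' : ℕ → QHarm.FracBar),
        QHarm.IsBeta k t v β → QHarm.IsBeta k (t - 1) v β' →
        QHarm.IsH β H → QHarm.IsH β' H' →
        H n ≠ 0 ∧
        algebraMap QHarm.Ser QHarm.FracBar (QHarm.genSer ζ n k)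
          = H' n / H n * (t / (t - 1))) := by
  have hq : ∀ m ∈ Finset.Ioo 0 n, ζ ^ m ≠ 1 := fun m hm => by
    rw [Finset.mem_Ioo] at hm
    exact hζ.pow_ne_one_of_pos_of_lt hm.1.ne' hm.2
  refine ⟨fun k hk => ⟨QHarm.prodPtilde_ne_zero _ hq, ?_⟩, fun k hk t v ht hv => ?_⟩
  · have hinj := IsFractionRing.injective QHarm.Ser QHarm.Frac
    rw [eq_div_iff ((map_ne_zero_iff _ hinj).mpr (QHarm.prodPtilde_ne_zero _ hq)), ← map_mul,
      QHarm.genSer_mul_prodPtilde hk hn hq]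
  · have hk1 : 1 ≤ k := by lia
    have hex : ∀ s : QHarm.FracBar, ∃ β : Fin k → QHarm.FracBar, QHarm.IsBeta k s v β ∧
        ∃ H : ℕ → QHarm.FracBar, QHarm.IsH β H := fun s => by
      obtain ⟨β, hβ⟩ := QHarm.exists_isBeta hk1 s v
      exact ⟨β, hβ, QHarm.exists_isH β⟩
    refine ⟨hex t, hex (t - 1), fun β β' H H' hβ hβ' hH hH' => ?_⟩
    have hinj := QHarm.algebraMap_ser_fracBar_injective
    have ht1 : t - 1 = algebraMap QHarm.Ser QHarm.FracBar (QHarm.tSer - 1) := by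
      rw [ht, map_sub, map_one]
    have ht1' : t - 1 ≠ 0 := by
      rw [ht1]; exact (map_ne_zero_iff _ hinj).mpr QHarm.tSer_sub_one_ne_zero
    rw [ht1, hv] at hβ'
    rw [ht, hv] at hβ
    have h : H n = algebraMap QHarm.Ser QHarm.FracBar
        (-(QHarm.tSer * QHarm.vSer) * QHarm.prodPtilde ζ n k QHarm.tSer) := by
      rw [hH.eq_prod hk1 hn, hβ.prod_pow_sub_one_eq_algebraMap hn hk hζ]
    have h' : H' n = algebraMap QHarm.Ser QHarm.FracBar
        (-((QHarm.tSer - 1) * QHarm.vSer) * QHarm.prodPtilde ζ n k (QHarm.tSer - 1)) := by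
      rw [hH'.eq_prod hk1 hn, hβ'.prod_pow_sub_one_eq_algebraMap hn hk hζ]
    have h0 : H n ≠ 0 := by
      rw [h]
      exact (map_ne_zero_iff _ hinj).mpr (mul_ne_zero (neg_ne_zero.mpr
        (mul_ne_zero QHarm.tSer_ne_zero PowerSeries.X_ne_zero)) (QHarm.prodPtilde_ne_zero _ hq))
    refine ⟨h0, ?_⟩
    -- After cross-multiplication both sides carry the factor -t(t-1)v, and what remains is the
    -- identity of part (1).
    rw [div_mul_div_comm, eq_div_iff (mul_ne_zero h0 ht1'), h, h', ht1, ht, ← map_mul, ← map_mul,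
      ← map_mul, ← QHarm.genSer_mul_prodPtilde hk1 hn hq]
    congr 1
    ring
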